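/- Let $K$ be any field. For a finite group $G$, let $G$ act on the rational function field $K(x(g) : g\in G)$ by $K$-automorphisms determined by $h\cdot x(g)=x(hg)$ for $g,h\in G$, and let $K(G)=K(x(g):g\in G)^G$ denote the fixed field. A field extension $L/K$ is called rational if it is purely transcendental, and stably rational if the rational function field $L(y_1,\dots,y_m)$ is rational over $K$ for some integer $m\ge 0$. For a positive integer $k$, let $D_k$ denote the dihedral group of order $2k$. Theorem 4.2. Let $n$ be a positive odd integer. If $K(\mathbb Z/n\mathbb Z)$ is rational over $K$, then both $K(D_n)$ and $K(D_{2n})$ are stably rational over $K$. -/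

import Mathlib

/-- The rational function field `K(x_s : s ∈ σ)`, i.e. the field of fractions of the polynomial
ring over `K` in variables indexed by `σ`. -/
abbrev RationalFunctionField (σ K : Type*) [Field K] : Type _ :=
  FractionRing (MvPolynomial σ K)

/-- A field extension `L / K` is rational (purely transcendental): `L = K(s)` for some set
`s ⊆ L` that is algebraically independent over `K`. -/
def IsRationalExtension (K L : Type*) [Field K] [Field L] [Algebra K L] : Prop :=
  ∃ s : Set L, AlgebraicIndependent K ((↑) : s → L) ∧ IntermediateField.adjoin K s = ⊤

/-- A field extension `L / K` is stably rational: for some natural number `m`, the rational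
function field `L(y_1, …, y_m)` in `m` variables over `L` is rational over `K`. -/
def IsStablyRationalExtension (K L : Type*) [Field K] [Field L] [Algebra K L] : Prop :=
  ∃ m : ℕ, IsRationalExtension K (RationalFunctionField (Fin m) L)

section Noether

variable (K : Type*) [Field K] (G : Type*) [Group G]

/-- The action of `G` on the polynomial ring `K[x(g) : g ∈ G]` by the `K`-algebra automorphisms
`h · x(g) = x(h g)`. -/
noncomputable def regularPolynomialAction :
    G →* (MvPolynomial G K ≃ₐ[K] MvPolynomial G K) where
  toFun h := MvPolynomial.renameEquiv K (Equiv.mulLeft h)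
  map_one' := by
    ext p
    simp
  map_mul' h₁ h₂ := by
    apply AlgEquiv.coe_toAlgHom_injective
    ext g : 1
    simp [mul_assoc]

/-- The induced action of `G` on the rational function field `K(x(g) : g ∈ G)` by `K`-algebra
automorphisms, with `h · x(g) = x(h g)`. -/
noncomputable def regularFieldAction :
    G →* (RationalFunctionField G K ≃ₐ[K] RationalFunctionField G K) :=
  (IsFractionRing.fieldEquivOfAlgEquivHom K (RationalFunctionField G K)).comp
    (regularPolynomialAction K G)

/-- Noether's field `K(G) = K(x(g) : g ∈ G)^G`, the field of `G`-invariants in the rational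
function field, as an intermediate field of `K(x(g) : g ∈ G) / K`. -/
noncomputable def noetherField : IntermediateField K (RationalFunctionField G K) :=
  IntermediateField.fixedField (regularFieldAction K G).range

end Noether

/-! Write A = ℤ/n, let Q be D_n or D_{2n}, and let C be trivial or ℤ/2 respectively, so that |Q| =
2|A||C|. The group W = A × Q permutes the set P = (Q ⊔ A) ⊔ ((A ⊔ A) ⊔ C), and the fixed field T =
K(P)^W is computed in two ways.

W acts by translations, faithfully, on Q ⊔ A, and the invariants there are the compositum of K(Q)
and K(A). The other variables can be replaced by invariant ones (`exists_invariant_generators`), so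
T is generated over K(Q) by |P| - |Q| elements (`exists_generators_over_noetherField`).

As n is odd, W also acts faithfully on (A ⊔ A) ⊔ C. It has the order of (A ≀ ℤ/2) × C, hence is that
whole group. The invariants are then symmetric combinations of two copies of K(A), together with
K(C), and T is generated over K by |P| elements (`exists_generators_of_swap`, via
`exists_symmetric_generators`).

Since T has transcendence degree |P| over K, both generating sets are algebraically independent: T
is rational over K and is a rational function field over K(Q)
(`isStablyRationalExtension_of_generators`). Thus only numbers of generators have to be tracked. A
field of invariants is recognised by a degree bound, `eq_fixedField_of_rank_le`. -/

open IntermediateField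

/-! ### Degree bounds for composita and fixed fields -/

section FieldDegree

variable {K E : Type*} [Field K] [Field E] [Algebra K E]

/-- Elements spanning B over A also span the compositum of M and B over M, because B is algebraic
over A. -/
theorem IntermediateField.relrank_sup_le {A B M : IntermediateField K E} (hAB : A ≤ B)
    (hAM : A ≤ M) {d : ℕ} (h : relrank A B ≤ d) : relrank M (M ⊔ B) ≤ d := by
  rw [relrank_eq_rank_of_le hAB] at h
  have hfin : Module.Finite A (extendScalars hAB) :=
    Module.rank_lt_aleph0_iff.1 (h.trans_lt Cardinal.natCast_lt_aleph0)
  let : Algebra A M := (inclusion hAM).toRingHom.toAlgebra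
  have : IsScalarTower A M E := IsScalarTower.of_algebraMap_eq fun _ => rfl
  have key := adjoin_rank_le_of_isAlgebraic_right (E := M) (extendScalars hAB)
  rw [relrank_eq_rank_of_le le_sup_left]
  refine le_trans (le_of_eq ?_) (key.trans h)
  have : extendScalars (le_sup_left : M ≤ M ⊔ B) =
      adjoin M ((extendScalars hAB : IntermediateField A E) : Set E) := by
    apply le_antisymm
    · intro x hx
      rw [mem_extendScalars] at hx
      have : M ⊔ B ≤ (adjoin M ((extendScalars hAB : IntermediateField A E) : Set E)).restrictScalars K :=
        sup_le (fun y hy => algebraMap_mem _ (⟨y, hy⟩ : M)) (fun y hy => subset_adjoin M _ hy)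
      exact this hx
    · rw [adjoin_le_iff]
      intro x hx
      exact (le_sup_right : B ≤ M ⊔ B) hx
  rw [this]

theorem IntermediateField.relrank_le_mul {A B C : IntermediateField K E} (hAB : A ≤ B)
    (hBC : B ≤ C) {d e : ℕ} (h₁ : relrank A B ≤ d) (h₂ : relrank B C ≤ e) :
    relrank A C ≤ (d * e : ℕ) := by
  rw [← relrank_mul_relrank hAB hBC]
  push_cast
  exact mul_le_mul' h₁ h₂

/-- If `M ≤ E^H` and `[E : M] ≤ |H|` then `M = E^H`. -/
theorem IntermediateField.eq_fixedField_of_rank_le {H : Subgroup (E ≃ₐ[K] E)} [Finite H]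
    {M : IntermediateField K E} (hM : M ≤ fixedField H)
    (h : relrank M ⊤ ≤ (Nat.card H : ℕ)) : M = fixedField H := by
  refine le_antisymm hM ?_
  have h1 : Module.finrank (fixedField H) E = Nat.card H := by
    have := Fintype.ofFinite H
    rw [Nat.card_eq_fintype_card]
    exact FixedPoints.finrank_eq_card H E
  have h3 := relfinrank_mul_finrank_top hM
  have h4 : Module.finrank M E ≤ Nat.card H := by
    rw [relrank_top_right] at h
    exact Module.finrank_le_of_rank_le h
  -- This excludes the value 0 that `finrank` takes in infinite degree, so that the tower formula
  -- `h3` can be cancelled.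
  have h5 : 0 < Module.finrank M E := by
    rw [relrank_top_right] at h
    have : Module.Finite M E := Module.rank_lt_aleph0_iff.1 (h.trans_lt Cardinal.natCast_lt_aleph0)
    exact Module.finrank_pos
  rw [h1] at h3
  have h6 : relfinrank M (fixedField H) = 1 := by
    have : 0 < Nat.card H := Nat.card_pos
    nlinarith [Nat.pos_of_ne_zero (n := relfinrank M (fixedField H)) (by rintro h0; rw [h0] at h3; omega)]
  exact relfinrank_eq_one_iff.1 h6

theorem IntermediateField.rank_fixedField_le (H : Subgroup (E ≃ₐ[K] E)) [Finite H] :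
    relrank (fixedField H) ⊤ ≤ (Nat.card H : ℕ) := by
  have := Fintype.ofFinite H
  rw [relrank_top_right, Nat.card_eq_fintype_card]
  exact FixedPoints.rank_le_card H E

theorem IntermediateField.mem_fixedField_range {G : Type*} [Group G] (ρ : G →* (E ≃ₐ[K] E)) (x : E) :
    x ∈ fixedField ρ.range ↔ ∀ g, ρ g x = x := by
  simp [mem_fixedField_iff]

end FieldDegree

/-! ### Galois descent (the no-name lemma) -/

section Descent

variable {K E : Type*} [Field K] [Field E] [Algebra K E]

/-- Descent for semilinear representations. -/
theorem exists_invariant_generators {G : Type*} [Group G] [Finite G] (ρ : G →* (E ≃ₐ[K] E))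
    (L : IntermediateField K E) (hL : ∀ g, ∀ l ∈ L, ρ g l ∈ L)
    (hfaithful : ∀ g, (∀ l ∈ L, ρ g l = l) → g = 1)
    {ι : Type*} [Finite ι] (x : ι → E) (hx : ∀ g i, ∃ j, ρ g (x i) = x j) :
    ∃ s : Finset E, s.card ≤ Nat.card ι ∧ (∀ y ∈ s, ∀ g, ρ g y = y) ∧
      ∀ i, x i ∈ L ⊔ adjoin K (s : Set E) := by
  classical
  have := Fintype.ofFinite G
  have := Fintype.ofFinite ι
  set V : Submodule L E := Submodule.span L (Set.range x) with hV
  set S : Set E := {v | v ∈ V ∧ ∀ g, ρ g v = v} with hS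
  have hSV : Submodule.span L S = V := by
    -- If some x i were not in the span of the invariants, a linear functional φ would kill all
    -- invariants but not x i. It kills in particular the trace of b * x i for every b in L.
    refine le_antisymm (Submodule.span_le.2 fun v hv => hv.1) (Submodule.span_le.2 ?_)
    rintro _ ⟨i, rfl⟩
    by_contra hi
    obtain ⟨φ, hφ, hker⟩ := Submodule.exists_le_ker_of_notMem hi
    have htrace : ∀ b : L, ∑ g, (ρ g (b : E)) * (φ (ρ g (x i)) : E) = 0 := by
      intro b
      have hmem : (∑ g, ρ g ((b : E) * x i)) ∈ S := by
        refine ⟨Submodule.sum_mem _ fun g _ => ?_, fun g => ?_⟩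
        · obtain ⟨j, hj⟩ := hx g i
          rw [map_mul, hj]
          exact V.smul_mem (⟨ρ g b, hL g b b.2⟩ : L) (Submodule.subset_span ⟨j, rfl⟩)
        · rw [map_sum]
          exact Fintype.sum_equiv (Equiv.mulLeft g) _ _ fun h => by
            simp
      have h0 : φ (∑ g, ρ g ((b : E) * x i)) = 0 := hker (Submodule.subset_span hmem)
      have h1 : φ (∑ g, ρ g ((b : E) * x i)) =
          ∑ g, (⟨ρ g b, hL g b b.2⟩ : L) * φ (ρ g (x i)) := by
        rw [map_sum]
        refine Finset.sum_congr rfl fun g _ => ?_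
        rw [map_mul, ← smul_eq_mul (⟨ρ g b, hL g b b.2⟩ : L), ← map_smul]
        rfl
      rw [h1] at h0
      have := congrArg (fun z : L => (z : E)) h0
      simpa using this
    -- By faithfulness the restrictions of the automorphisms to L are distinct characters. Dedekind
    -- independence makes every coefficient in `htrace` vanish; the one at g = 1 is φ (x i).
    let χ : G → (L →* E) := fun g => ((ρ g : E ≃ₐ[K] E) : E →* E).comp (L.val : L →* E)
    have hχ : Function.Injective χ := by
      intro g h hgh
      have : h⁻¹ * g = 1 := hfaithful _ fun l hl => by
        have h1 : ρ g l = ρ h l := DFunLike.congr_fun hgh (⟨l, hl⟩ : L)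
        rw [map_mul, AlgEquiv.mul_apply, h1, ← AlgEquiv.mul_apply, ← map_mul]
        simp
      exact (inv_mul_eq_one.1 this).symm
    have hind := (linearIndependent_monoidHom L E).comp χ hχ
    have hz := Fintype.linearIndependent_iff.1 hind (fun g => (φ (ρ g (x i)) : E)) (by
      ext b
      simp only [Finset.sum_apply, Function.comp, Pi.smul_apply, smul_eq_mul, Pi.zero_apply]
      rw [← htrace b]
      exact Finset.sum_congr rfl fun g _ => mul_comm _ _) 1
    apply hφ
    simpa using hz
  -- A basis of V chosen among the invariants has dim V elements, which is at most the number of the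
  -- x i.
  obtain ⟨b, hbS, hbspan, hbind⟩ := exists_linearIndependent L S
  have hVfin : Module.Finite L V := by
    rw [hV]; exact Module.Finite.span_of_finite L (Set.finite_range x)
  have hcard : Cardinal.mk b = Module.rank L V := by
    rw [← hSV, ← hbspan, rank_span_set hbind]
  have hbfin : b.Finite := by
    rw [← Cardinal.lt_aleph0_iff_set_finite, hcard]
    exact Module.rank_lt_aleph0 L V
  refine ⟨hbfin.toFinset, ?_, ?_, ?_⟩
  · rw [← Set.ncard_eq_toFinset_card b hbfin, Set.ncard, Set.encard]
    have h1 : Nat.card b = Module.finrank L V := by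
      rw [Nat.card, hcard]; rfl
    rw [← Set.encard, ← Set.ncard, ← Nat.card_coe_set_eq, h1, Nat.card_eq_fintype_card]
    exact finrank_range_le_card x
  · intro y hy
    exact (hbS (hbfin.mem_toFinset.1 hy)).2
  · intro i
    have hxi : x i ∈ Submodule.span L b := by
      rw [hbspan, hSV]; exact Submodule.subset_span ⟨i, rfl⟩
    rw [Set.Finite.coe_toFinset]
    generalize x i = z at hxi
    induction hxi using Submodule.span_induction with
    | mem y hy => exact (le_sup_right : _ ≤ L ⊔ adjoin K b) (subset_adjoin K b hy)
    | zero => exact zero_mem _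
    | add y z _ _ h1 h2 => exact add_mem h1 h2
    | smul a y _ h => exact mul_mem ((le_sup_left : L ≤ L ⊔ adjoin K b) a.2) h

end Descent

/-! ### Variables, embeddings and permutations of rational function fields -/

namespace RationalFunctionField

variable (K : Type*) [Field K] {σ τ : Type*}

/-- The variables of the rational function field. -/
noncomputable def var (i : σ) : RationalFunctionField σ K :=
  algebraMap (MvPolynomial σ K) _ (MvPolynomial.X i)

theorem algebraicIndependent_var :
    AlgebraicIndependent K (var K : σ → RationalFunctionField σ K) :=
  (MvPolynomial.algebraicIndependent_X σ K).map'
    (f := IsScalarTower.toAlgHom K (MvPolynomial σ K) (RationalFunctionField σ K))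
    (IsFractionRing.injective _ _)

theorem algebraMap_eq_aeval_var (p : MvPolynomial σ K) :
    algebraMap (MvPolynomial σ K) (RationalFunctionField σ K) p = MvPolynomial.aeval (var K) p := by
  have : IsScalarTower.toAlgHom K (MvPolynomial σ K) (RationalFunctionField σ K) =
      MvPolynomial.aeval (var K) := by
    apply MvPolynomial.algHom_ext
    intro i
    simp [var]
  exact DFunLike.congr_fun this p

theorem adjoin_range_var : adjoin K (Set.range (var K : σ → RationalFunctionField σ K)) = ⊤ := by
  rw [eq_top_iff]
  rintro x -
  obtain ⟨p, q, -, rfl⟩ := IsFractionRing.div_surjective (MvPolynomial σ K) x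
  have h : ∀ p : MvPolynomial σ K, algebraMap _ (RationalFunctionField σ K) p ∈
      adjoin K (Set.range (var K : σ → RationalFunctionField σ K)) := by
    intro p
    rw [algebraMap_eq_aeval_var]
    exact algebra_adjoin_le_adjoin K _ (by
      rw [Algebra.adjoin_range_eq_range_aeval]; exact ⟨p, rfl⟩)
  exact div_mem (h p) (h q)

variable {K}

theorem algHom_ext {E : Type*} [Field E] [Algebra K E] {f g : RationalFunctionField σ K →ₐ[K] E}
    (h : ∀ i, f (var K i) = g (var K i)) : f = g := by
  refine AlgHom.ext fun x => ?_
  have : x ∈ adjoin K (Set.range (var K : σ → RationalFunctionField σ K)) := by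
    rw [adjoin_range_var]; trivial
  induction this using adjoin_induction with
  | mem y hy => obtain ⟨i, rfl⟩ := hy; exact h i
  | algebraMap a => simp
  | add y z _ _ hy hz => simp [hy, hz]
  | inv y _ hy => simp [hy]
  | mul y z _ _ hy hz => simp [hy, hz]

theorem algEquiv_ext {E : Type*} [Field E] [Algebra K E] {f g : RationalFunctionField σ K ≃ₐ[K] E}
    (h : ∀ i, f (var K i) = g (var K i)) : f = g :=
  AlgEquiv.coe_toAlgHom_injective (algHom_ext h)

variable (K)

/-- The embedding of rational function fields induced by an injection of the sets of variables. -/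
noncomputable def map (f : σ ↪ τ) : RationalFunctionField σ K →ₐ[K] RationalFunctionField τ K :=
  IsFractionRing.liftAlgHom (g := MvPolynomial.aeval fun i => var K (f i))
    (algebraicIndependent_iff_injective_aeval.1 ((algebraicIndependent_var K).comp f f.injective))

@[simp]
theorem map_var (f : σ ↪ τ) (i : σ) : map K f (var K i) = var K (f i) := by
  simp [map, var]

/-- The action of the permutations of the variables on the rational function field. -/
noncomputable def perm : Equiv.Perm σ →* (RationalFunctionField σ K ≃ₐ[K] RationalFunctionField σ K) where
  toFun e := IsFractionRing.fieldEquivOfAlgEquivHom K _ (MvPolynomial.renameEquiv K e)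
  map_one' := by
    apply algEquiv_ext
    intro i
    simp [var]
  map_mul' e e' := by
    apply algEquiv_ext
    intro i
    simp [var]

@[simp]
theorem perm_var (e : Equiv.Perm σ) (i : σ) : perm K e (var K i) = var K (e i) := by
  simp [perm, var]

theorem var_injective : Function.Injective (var K : σ → RationalFunctionField σ K) :=
  (algebraicIndependent_var K).injective

theorem trdeg_eq (σ : Type*) (K : Type*) [Field K] [Fintype σ] :
    Algebra.trdeg K (RationalFunctionField σ K) = Fintype.card σ := by
  have halg : Algebra.IsAlgebraic
      (Algebra.adjoin K (Set.range (var K : σ → RationalFunctionField σ K)))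
      (RationalFunctionField σ K) := by
    rw [← isAlgebraic_adjoin_iff_top, adjoin_range_var, Algebra.isAlgebraic_iff_isIntegral]
    exact Algebra.isIntegral_of_surjective topEquiv.surjective
  have h : IsTranscendenceBasis K (var K : σ → RationalFunctionField σ K) :=
    (algebraicIndependent_var K).isTranscendenceBasis_iff_isAlgebraic.2 halg
  have h1 := h.lift_cardinalMk_eq_trdeg
  rw [Cardinal.mk_fintype, Cardinal.lift_natCast] at h1
  exact Cardinal.lift_injective (by rw [← h1, Cardinal.lift_natCast])

end RationalFunctionField

/-! ### Independence and rationality by counting generators -/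

theorem algebraicIndependent_of_card_le_trdeg {F E : Type*} [Field F] [Field E] [Algebra F E]
    (s : Finset E) [Algebra.IsAlgebraic (adjoin F (s : Set E)) E]
    (h : (s.card : Cardinal) ≤ Algebra.trdeg F E) :
    AlgebraicIndependent F (Subtype.val : s → E) := by
  have halg : Algebra.IsAlgebraic (Algebra.adjoin F (Set.range (Subtype.val : s → E))) E := by
    rw [← isAlgebraic_adjoin_iff_top]
    have : Set.range (Subtype.val : s → E) = s := Subtype.range_coe
    rw [this]
    infer_instance
  exact (Algebra.IsAlgebraic.isTranscendenceBasis_of_le_trdeg_of_finite F _ (by simpa using h)).1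

theorem IsRationalExtension.of_algEquiv {K L L' : Type*} [Field K] [Field L] [Field L']
    [Algebra K L] [Algebra K L'] (h : IsRationalExtension K L) (e : L ≃ₐ[K] L') :
    IsRationalExtension K L' := by
  obtain ⟨s, hs, hadj⟩ := h
  refine ⟨e '' s, ?_, ?_⟩
  · have h1 : AlgebraicIndependent K (fun x : s => e x) :=
      hs.map' (f := (e : L →ₐ[K] L')) e.injective
    have h2 : Set.range (fun x : s => e x) = e '' s := by
      rw [Set.image_eq_range]
    rw [← h2]
    exact h1.to_subtype_range
  · have := congrArg (IntermediateField.map (e : L →ₐ[K] L')) hadj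
    rw [adjoin_map] at this
    rw [show e '' s = (e : L →ₐ[K] L') '' s from rfl, this, ← AlgHom.fieldRange_eq_map,
      AlgHom.fieldRange_eq_top]
    exact e.surjective

theorem isRationalExtension_rationalFunctionField (σ K : Type*) [Field K] :
    IsRationalExtension K (RationalFunctionField σ K) :=
  ⟨Set.range (RationalFunctionField.var K),
    (RationalFunctionField.algebraicIndependent_var K).to_subtype_range,
    RationalFunctionField.adjoin_range_var K⟩

theorem IsRationalExtension.exists_finset {K L : Type*} [Field K] [Field L] [Algebra K L]
    (h : IsRationalExtension K L) {d : ℕ} (hd : Algebra.trdeg K L ≤ d) :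
    ∃ s : Finset L, s.card ≤ d ∧ adjoin K (s : Set L) = ⊤ := by
  obtain ⟨s, hs, hadj⟩ := h
  have hc : Cardinal.mk s ≤ d := hs.cardinalMk_le_trdeg.trans hd
  have hfin : s.Finite :=
    Cardinal.lt_aleph0_iff_set_finite.1 (hc.trans_lt Cardinal.natCast_lt_aleph0)
  refine ⟨hfin.toFinset, ?_, by simpa using hadj⟩
  have h1 : Cardinal.mk s = hfin.toFinset.card := by
    rw [← Cardinal.mk_coe_finset]
    exact Cardinal.mk_congr (Equiv.setCongr hfin.coe_toFinset.symm)
  rw [h1] at hc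
  exact_mod_cast hc

/-- T is described as N adjoined at most m elements and as K adjoined at most d elements. By
additivity of transcendence degree, E has degree at least m over N and exactly d over K, so neither
generating set can be dependent. Hence T is at once N(y_1, …, y_r), with r the size of s, and
rational over K. -/
theorem isStablyRationalExtension_of_generators.{u, v, w} {K : Type u} {N : Type v} {E : Type w} [Field K] [Field N]
    [Field E] [Algebra K N] [Algebra K E] (f : N →ₐ[K] E) (T : IntermediateField K E)
    [Algebra.IsAlgebraic T E] {q m d : ℕ} (hN : Algebra.trdeg K N = q)
    (hE : Algebra.trdeg K E = d) (hd : m + q ≤ d) {s t : Finset E} (hs : s.card ≤ m) (ht : t.card ≤ d)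
    (hsT : f.fieldRange ⊔ adjoin K (s : Set E) = T) (htT : adjoin K (t : Set E) = T) :
    IsStablyRationalExtension K N := by
  let : Algebra N E := f.toRingHom.toAlgebra
  have : IsScalarTower K N E := IsScalarTower.of_algebraMap_eq fun x => (f.commutes x).symm
  have hres : (adjoin N (s : Set E)).restrictScalars K = T := by
    rw [← hsT]
    apply le_antisymm
    · intro x hx
      rw [mem_restrictScalars] at hx
      induction hx using adjoin_induction with
      | mem y hy => exact (le_sup_right : _ ≤ f.fieldRange ⊔ adjoin K (s : Set E)) (subset_adjoin K _ hy)
      | algebraMap a => exact (le_sup_left : _ ≤ f.fieldRange ⊔ adjoin K (s : Set E)) ⟨a, rfl⟩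
      | add y z _ _ hy hz => exact add_mem hy hz
      | inv y _ hy => exact inv_mem hy
      | mul y z _ _ hy hz => exact mul_mem hy hz
    · refine sup_le ?_ ?_
      · rintro _ ⟨a, rfl⟩
        exact IntermediateField.algebraMap_mem (adjoin N (s : Set E)) a
      · rw [adjoin_le_iff]
        exact subset_adjoin N _
  have hlift := lift_trdeg_add_eq K N E
  rw [hN, hE, Cardinal.lift_natCast, Cardinal.lift_natCast] at hlift
  have hNE : (m : Cardinal) ≤ Algebra.trdeg N E := by
    rw [← Cardinal.lift_le.{v}, Cardinal.lift_natCast]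
    refine (Cardinal.add_le_add_iff_of_lt_aleph0 (Cardinal.natCast_lt_aleph0 (n := q))).1 ?_
    rw [add_comm (Cardinal.lift.{v} _), hlift]
    exact_mod_cast hd
  have halg : Algebra.IsAlgebraic (adjoin N (s : Set E)) E := by
    have : Algebra.IsAlgebraic ((adjoin N (s : Set E)).restrictScalars K) E := by
      rw [hres]; infer_instance
    exact this
  have hind := algebraicIndependent_of_card_le_trdeg (F := N) s
    ((Nat.cast_le.2 hs).trans hNE)
  have halg' : Algebra.IsAlgebraic (adjoin K (t : Set E)) E := by
    rw [htT]; infer_instance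
  have hind' := algebraicIndependent_of_card_le_trdeg (F := K) t
    ((Nat.cast_le.2 ht).trans hE.ge)
  have hr : ∀ s : Finset E, Set.range (Subtype.val : s → E) = s := fun s => Subtype.range_coe
  have hTrat : IsRationalExtension K T := by
    refine (isRationalExtension_rationalFunctionField t K).of_algEquiv
      (hind'.aevalEquivField.trans (equivOfEq ?_))
    rw [hr, htT]
  let σ : Fin s.card ≃ s := s.equivFin.symm
  have hindσ : AlgebraicIndependent N (fun i => (σ i : E)) := hind.comp σ σ.injective
  refine ⟨s.card, hTrat.of_algEquiv ?_⟩
  have hrσ : Set.range (fun i => (σ i : E)) = s := by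
    rw [← hr s]
    exact σ.surjective.range_comp (Subtype.val : s → E)
  have hres' : (adjoin N (Set.range fun i => (σ i : E))).restrictScalars K = T := by
    rw [hrσ, hres]
  exact ((hindσ.aevalEquivField.restrictScalars K).trans (equivOfEq hres' :)).symm

/-! ### Noether fields and their numbers of generators -/

section NoetherField

variable (K : Type*) [Field K] {G : Type*} [Group G]

theorem mem_noetherField_iff (x : RationalFunctionField G K) :
    x ∈ noetherField K G ↔ ∀ g, regularFieldAction K G g x = x :=
  mem_fixedField_range (regularFieldAction K G) x

theorem regularFieldAction_eq_perm (g : G) :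
    regularFieldAction K G g = RationalFunctionField.perm K (Equiv.mulLeft g) := by
  apply RationalFunctionField.algEquiv_ext
  intro i
  rw [RationalFunctionField.perm_var]
  simp [regularFieldAction, regularPolynomialAction, RationalFunctionField.var]

/-- The translation by b is invisible to invariants, so a permutation carrying one copy of G to
another up to translation just identifies the two copies of K(G). -/
theorem perm_map_of_mem_noetherField {P : Type*} (e : Equiv.Perm P) (j j' : G ↪ P) (b : G)
    (h : ∀ a, e (j a) = j' (b * a)) {x : RationalFunctionField G K} (hx : x ∈ noetherField K G) :
    RationalFunctionField.perm K e (RationalFunctionField.map K j x) =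
      RationalFunctionField.map K j' x := by
  have key : ((RationalFunctionField.perm K e : _ →ₐ[K] _).comp (RationalFunctionField.map K j)) =
      (RationalFunctionField.map K j').comp (regularFieldAction K G b : _ →ₐ[K] _) := by
    apply RationalFunctionField.algHom_ext
    intro i
    simp [regularFieldAction_eq_perm, h]
  have := DFunLike.congr_fun key x
  have h2 := (mem_noetherField_iff K x).1 hx b
  simpa [h2] using this

instance finite_range_regularFieldAction [Finite G] : Finite (regularFieldAction K G).range :=
  Finite.of_surjective _ (regularFieldAction K G).rangeRestrict_surjective

/-- `K(G)` is generated over `K` by at most `|G|` elements. -/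
def HasNoetherGenerators (K : Type*) [Field K] (G : Type*) [Group G] : Prop :=
  ∃ s : Finset (RationalFunctionField G K), s.card ≤ Nat.card G ∧
    adjoin K (s : Set (RationalFunctionField G K)) = noetherField K G

theorem hasNoetherGenerators_of_subsingleton [Subsingleton G] : HasNoetherGenerators K G := by
  refine ⟨{RationalFunctionField.var K 1}, by simp, ?_⟩
  have : ({RationalFunctionField.var K (1 : G)} : Set _) = Set.range (RationalFunctionField.var K) := by
    ext x
    simp only [Set.mem_singleton_iff, Set.mem_range]
    exact ⟨fun h => ⟨1, h.symm⟩, fun ⟨g, h⟩ => by rw [← h, Subsingleton.elim g 1]⟩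
  rw [Finset.coe_singleton, this, RationalFunctionField.adjoin_range_var, eq_comm, eq_top_iff]
  intro x _
  rw [mem_noetherField_iff]
  intro g
  rw [Subsingleton.elim g 1, map_one]
  rfl

variable [Finite G]

theorem relrank_map_noetherField_le {P : Type*} (j : G ↪ P) :
    relrank ((noetherField K G).map (RationalFunctionField.map K j))
      (RationalFunctionField.map K j).fieldRange ≤ (Nat.card G : ℕ) := by
  have h1 : relrank (noetherField K G) ⊤ ≤ (Nat.card G : ℕ) := by
    refine (rank_fixedField_le (regularFieldAction K G).range).trans ?_
    exact_mod_cast Nat.card_le_card_of_surjective _ (regularFieldAction K G).rangeRestrict_surjective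
  have h2 := lift_relrank_map_map (noetherField K G) ⊤ (RationalFunctionField.map K j)
  rw [AlgHom.fieldRange_eq_map]
  rw [← Cardinal.lift_le, h2, Cardinal.lift_natCast]
  simpa using h1

theorem isAlgebraic_noetherField :
    Algebra.IsAlgebraic (noetherField K G) (RationalFunctionField G K) := by
  have : Module.rank (noetherField K G) (RationalFunctionField G K) ≤
      (Nat.card (regularFieldAction K G).range : ℕ) := by
    rw [← relrank_top_right]
    exact rank_fixedField_le (regularFieldAction K G).range
  have : Module.Finite (noetherField K G) (RationalFunctionField G K) :=
    Module.rank_lt_aleph0_iff.1 (this.trans_lt Cardinal.natCast_lt_aleph0)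
  infer_instance

theorem trdeg_noetherField : Algebra.trdeg K (noetherField K G) = Nat.card G := by
  have := Fintype.ofFinite G
  have := isAlgebraic_noetherField K (G := G)
  have h := trdeg_add_eq K (noetherField K G) (A := RationalFunctionField G K)
  rw [RationalFunctionField.trdeg_eq, trdeg_eq_zero (R := noetherField K G), add_zero] at h
  rw [h, Nat.card_eq_fintype_card]

/-- The only form in which rationality of K(ℤ/n) is used: a purely transcendental generating set has
no more elements than the transcendence degree |G|. -/
theorem IsRationalExtension.hasNoetherGenerators {K : Type*} [Field K]
    (h : IsRationalExtension K (noetherField K G)) : HasNoetherGenerators K G := by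
  classical
  obtain ⟨s, hs, hadj⟩ := h.exists_finset (trdeg_noetherField K).le
  refine ⟨s.image (noetherField K G).val, Finset.card_image_le.trans hs, ?_⟩
  rw [Finset.coe_image, ← adjoin_map, hadj, ← AlgHom.fieldRange_eq_map, fieldRange_val]

end NoetherField

/-! ### Quadratic extensions and symmetric generators -/

section Quadratic

variable {K E : Type*} [Field K] [Field E] [Algebra K E]

/-- α is a root of X² - (α + β)X + αβ. This form works in every characteristic. -/
theorem IntermediateField.relrank_adjoin_pair_le (α β : E) :
    relrank (adjoin K {α + β, α * β}) (adjoin K {α + β, α * β} ⊔ adjoin K {α}) ≤ (2 : ℕ) := by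
  set M := adjoin K {α + β, α * β} with hM
  have hs : α + β ∈ M := subset_adjoin K _ (by simp)
  have hp : α * β ∈ M := subset_adjoin K _ (by simp)
  set p : Polynomial M := Polynomial.X ^ 2 - Polynomial.C (⟨α + β, hs⟩ : M) * Polynomial.X +
    Polynomial.C (⟨α * β, hp⟩ : M) with hpdef
  have hmonic : p.Monic := by rw [hpdef]; monicity!
  have hdeg : p.natDegree ≤ 2 := by rw [hpdef]; compute_degree
  have hroot : Polynomial.aeval α p = 0 := by
    have h1 : algebraMap M E ⟨α + β, hs⟩ = α + β := rfl
    have h2 : algebraMap M E ⟨α * β, hp⟩ = α * β := rfl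
    simp only [hpdef, map_add, map_sub, map_mul, map_pow, Polynomial.aeval_X, Polynomial.aeval_C,
      h1, h2]
    ring
  have hint : IsIntegral M α := ⟨p, hmonic, hroot⟩
  have hext : extendScalars (le_sup_left : M ≤ M ⊔ adjoin K {α}) = adjoin M {α} := by
    apply le_antisymm
    · intro x hx
      rw [mem_extendScalars] at hx
      have : M ⊔ adjoin K {α} ≤ (adjoin M {α}).restrictScalars K :=
        sup_le (fun y hy => IntermediateField.algebraMap_mem _ (⟨y, hy⟩ : M))
          (adjoin_le_iff.2 (subset_adjoin M {α}))
      exact this hx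
    · rw [adjoin_le_iff, Set.singleton_subset_iff]
      exact (le_sup_right : adjoin K {α} ≤ M ⊔ adjoin K {α}) (mem_adjoin_simple_self K α)
  rw [relrank_eq_rank_of_le le_sup_left, hext]
  have := adjoin.finiteDimensional hint
  rw [← Module.finrank_eq_rank, adjoin.finrank hint]
  have h3 := Polynomial.natDegree_le_of_dvd (minpoly.dvd M α hroot) hmonic.ne_zero
  exact_mod_cast h3.trans hdeg

/-- Generators of the invariants of the swap of two copies of a finitely generated field. -/
theorem exists_symmetric_generators {X : Type*} [DecidableEq X] [DecidableEq E] (φ ψ : X → E)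
    (s : Finset X) {u₀ : X} (hu₀ : u₀ ∈ s) (hne : φ u₀ ≠ ψ u₀) :
    ∃ t : Finset E, t.card ≤ 2 * s.card ∧
      (∀ y ∈ t, ∃ u ∈ s, y = φ u + ψ u ∨ y = φ u₀ * ψ u + ψ u₀ * φ u ∨ y = φ u₀ * ψ u₀) ∧
      ∃ B : IntermediateField K E, adjoin K (t : Set E) ≤ B ∧
        relrank (adjoin K (t : Set E)) B ≤ (2 : ℕ) ∧ ∀ u ∈ s, φ u ∈ B ∧ ψ u ∈ B := by
  -- The mixed element for u = u₀ would be 2 φ(u₀) ψ(u₀), useless in characteristic 2, so the plain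
  -- product replaces it. The count is 1 + |s| + (|s| - 1) = 2|s|.
  set t : Finset E := insert (φ u₀ * ψ u₀) (s.image (fun u => φ u + ψ u) ∪
    (s.erase u₀).image fun u => φ u₀ * ψ u + ψ u₀ * φ u) with ht
  refine ⟨t, ?_, ?_, ?_⟩
  · have h1 := Finset.card_insert_le (φ u₀ * ψ u₀) (s.image (fun u => φ u + ψ u) ∪
      (s.erase u₀).image fun u => φ u₀ * ψ u + ψ u₀ * φ u)
    have h2 := Finset.card_union_le (s.image (fun u => φ u + ψ u))
      ((s.erase u₀).image fun u => φ u₀ * ψ u + ψ u₀ * φ u)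
    have h3 := Finset.card_image_le (s := s) (f := fun u => φ u + ψ u)
    have h4 := Finset.card_image_le (s := s.erase u₀) (f := fun u => φ u₀ * ψ u + ψ u₀ * φ u)
    have h5 := Finset.card_erase_add_one hu₀
    rw [← ht] at h1
    omega
  · intro y hy
    simp only [ht, Finset.mem_insert, Finset.mem_union, Finset.mem_image, Finset.mem_erase] at hy
    rcases hy with rfl | ⟨u, hu, rfl⟩ | ⟨u, ⟨_, hu⟩, rfl⟩
    · exact ⟨u₀, hu₀, by simp⟩
    · exact ⟨u, hu, by simp⟩
    · exact ⟨u, hu, by simp⟩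
  · set M := adjoin K (t : Set E) with hM
    set D := adjoin K {φ u₀ + ψ u₀, φ u₀ * ψ u₀} with hD
    have htM : ∀ y ∈ t, y ∈ M := fun y hy => subset_adjoin K _ hy
    have hsum : ∀ u ∈ s, φ u + ψ u ∈ M := fun u hu => htM _ (by
      simp only [ht, Finset.mem_insert, Finset.mem_union, Finset.mem_image]
      exact Or.inr (Or.inl ⟨u, hu, rfl⟩))
    have hprod : φ u₀ * ψ u₀ ∈ M := htM _ (by simp [ht])
    have hDM : D ≤ M := by
      rw [hD, adjoin_le_iff]
      rintro y (rfl | rfl)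
      · exact hsum u₀ hu₀
      · exact hprod
    set B := M ⊔ (D ⊔ adjoin K {φ u₀}) with hB
    have hMB : M ≤ B := le_sup_left
    have hφ₀ : φ u₀ ∈ B := (le_sup_right.trans le_sup_right : adjoin K {φ u₀} ≤ B)
      (mem_adjoin_simple_self K _)
    have hψ₀ : ψ u₀ ∈ B := by
      have := sub_mem (hMB (hsum u₀ hu₀)) hφ₀
      simpa using this
    refine ⟨B, hMB, ?_, fun u hu => ?_⟩
    · exact relrank_sup_le le_sup_left hDM (relrank_adjoin_pair_le _ _)
    · by_cases huu : u = u₀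
      · subst huu; exact ⟨hφ₀, hψ₀⟩
      have hmix : φ u₀ * ψ u + ψ u₀ * φ u ∈ B := hMB (htM _ (by
        simp only [ht, Finset.mem_insert, Finset.mem_union, Finset.mem_image, Finset.mem_erase]
        exact Or.inr (Or.inr ⟨u, ⟨huu, hu⟩, rfl⟩)))
      -- Once φ(u₀) and ψ(u₀) are available, the sum and the mixed element form a linear system in
      -- φ(u), ψ(u) with determinant ±(φ(u₀) - ψ(u₀)). One quadratic extension therefore recovers
      -- everything.
      have hsub : φ u₀ - ψ u₀ ≠ 0 := sub_ne_zero.2 hne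
      have hψ : ψ u ∈ B := by
        have h1 : ψ u = (φ u₀ * ψ u + ψ u₀ * φ u - ψ u₀ * (φ u + ψ u)) / (φ u₀ - ψ u₀) := by
          field_simp
          ring
        rw [h1]
        exact div_mem (sub_mem hmix (mul_mem hψ₀ (hMB (hsum u hu)))) (sub_mem hφ₀ hψ₀)
      refine ⟨?_, hψ⟩
      have := sub_mem (hMB (hsum u hu)) hψ
      simpa using this

end Quadratic

/-! ### The group of order two, and descent for permuted variables -/

theorem regularFieldAction_injective (K : Type*) [Field K] (G : Type*) [Group G] :
    Function.Injective (regularFieldAction K G) := by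
  intro g h hgh
  rw [regularFieldAction_eq_perm, regularFieldAction_eq_perm] at hgh
  have := DFunLike.congr_fun hgh (RationalFunctionField.var K 1)
  simpa using RationalFunctionField.var_injective K (by simpa using this)

theorem hasNoetherGenerators_zmod_two (K : Type*) [Field K] :
    HasNoetherGenerators K (Multiplicative (ZMod 2)) := by
  classical
  set G := Multiplicative (ZMod 2)
  set g : G := Multiplicative.ofAdd 1 with hg
  set x := RationalFunctionField.var K (1 : G)
  set y := RationalFunctionField.var K g
  have hcases : ∀ a : G, a = 1 ∨ a = g := by decide
  have hgg : g * g = 1 := by decide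
  have hcard : Nat.card G = 2 := by simp [G]
  refine ⟨{x + y, x * y}, ?_, ?_⟩
  · rw [hcard]; exact Finset.card_le_two
  · rw [Finset.coe_pair]
    refine eq_fixedField_of_rank_le (H := (regularFieldAction K G).range) ?_ ?_
    · change _ ≤ noetherField K G
      rw [adjoin_le_iff]
      have hx : regularFieldAction K G g x = y := by
        simp [regularFieldAction_eq_perm, x, y]
      have hy : regularFieldAction K G g y = x := by
        simp [regularFieldAction_eq_perm, x, y, hgg]
      rintro z (rfl | rfl) <;> refine (mem_noetherField_iff K _).2 fun a => ?_ <;>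
        rcases hcases a with rfl | rfl
      · simp
      · rw [map_add, hx, hy, add_comm]
      · simp
      · rw [map_mul, hx, hy, mul_comm]
    · have h1 : Nat.card (regularFieldAction K G).range = 2 := by
        refine Eq.trans ?_ hcard
        exact (Nat.card_congr (MonoidHom.ofInjective (regularFieldAction_injective K G)).toEquiv).symm
      rw [h1]
      have h2 := relrank_adjoin_pair_le (K := K) x y
      have h3 : adjoin K {x + y, x * y} ⊔ adjoin K {x} = ⊤ := by
        rw [eq_top_iff, ← RationalFunctionField.adjoin_range_var, adjoin_le_iff]
        rintro _ ⟨a, rfl⟩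
        have hx : x ∈ adjoin K {x + y, x * y} ⊔ adjoin K {x} :=
          (le_sup_right : adjoin K {x} ≤ _) (mem_adjoin_simple_self K x)
        rcases hcases a with rfl | rfl
        · exact hx
        · have hs : x + y ∈ adjoin K {x + y, x * y} ⊔ adjoin K {x} :=
            (le_sup_left : adjoin K {x + y, x * y} ≤ _) (subset_adjoin K _ (by simp))
          have := sub_mem hs hx
          simpa using this
      rwa [h3] at h2

/-- If a finite group `W` permutes two disjoint sets `S`, `T` of variables, acting faithfully on `S`,
then `K(S, T)` is generated over `K(S)` by at most `|T|` invariants. -/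
theorem exists_invariants_sup_eq_top (K : Type*) [Field K] {W P S T : Type*} [Group W] [Finite W]
    [Finite T] (ω : W →* Equiv.Perm P) (j : S → P) (k : T → P)
    (hjk : ∀ p, (∃ s, j s = p) ∨ ∃ t, k t = p)
    (hj : ∀ w s, ∃ s', ω w (j s) = j s') (hk : ∀ w t, ∃ t', ω w (k t) = k t')
    (hfaithful : ∀ w, (∀ s, ω w (j s) = j s) → w = 1) :
    ∃ s : Finset (RationalFunctionField P K), s.card ≤ Nat.card T ∧
      (∀ y ∈ s, ∀ w, RationalFunctionField.perm K (ω w) y = y) ∧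
      adjoin K (Set.range fun i => RationalFunctionField.var K (j i)) ⊔ adjoin K (s : Set _) = ⊤ := by
  set L := adjoin K (Set.range fun i => RationalFunctionField.var K (j i)) with hL
  have hvar : ∀ s, RationalFunctionField.var K (j s) ∈ L := fun s => subset_adjoin K _ ⟨s, rfl⟩
  have h1 : ∀ w, ∀ l ∈ L, ((RationalFunctionField.perm K).comp ω) w l ∈ L := by
    intro w l hl
    have h1 : L ≤ L.comap (RationalFunctionField.perm K (ω w) : _ →ₐ[K] _) := by
      rw [hL, adjoin_le_iff]
      rintro _ ⟨i, rfl⟩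
      obtain ⟨i', hi'⟩ := hj w i
      change RationalFunctionField.perm K (ω w) _ ∈ L
      rw [RationalFunctionField.perm_var, hi']
      exact hvar i'
    exact h1 hl
  have h2 : ∀ w, (∀ l ∈ L, ((RationalFunctionField.perm K).comp ω) w l = l) → w = 1 := by
    intro w hw
    refine hfaithful w fun i => ?_
    have := hw _ (hvar i)
    rw [MonoidHom.comp_apply, RationalFunctionField.perm_var] at this
    exact RationalFunctionField.var_injective K this
  have h3 : ∀ w t, ∃ t', ((RationalFunctionField.perm K).comp ω) w (RationalFunctionField.var K (k t)) =
      RationalFunctionField.var K (k t') := by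
    intro w t
    obtain ⟨t', ht'⟩ := hk w t
    exact ⟨t', by rw [MonoidHom.comp_apply, RationalFunctionField.perm_var, ht']⟩
  obtain ⟨s, hcard, hinv, hmem⟩ := exists_invariant_generators
    ((RationalFunctionField.perm K).comp ω) L h1 h2 (fun t => RationalFunctionField.var K (k t)) h3
  refine ⟨s, hcard, hinv, ?_⟩
  rw [eq_top_iff, ← RationalFunctionField.adjoin_range_var, adjoin_le_iff]
  rintro _ ⟨p, rfl⟩
  rcases hjk p with ⟨i, rfl⟩ | ⟨i, rfl⟩
  · exact (le_sup_left : L ≤ _) (hvar i)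
  · exact hmem i

/-- Two embeddings with disjoint images are distinguished by the invariants. -/
theorem exists_mem_noetherField_map_ne (K : Type*) [Field K] {G P : Type*} [Group G] [Finite G]
    (j j' : G ↪ P) (h : ∀ a b, j a ≠ j' b) :
    ∃ x ∈ noetherField K G, RationalFunctionField.map K j x ≠ RationalFunctionField.map K j' x := by
  classical
  have := Fintype.ofFinite G
  refine ⟨∑ g, RationalFunctionField.var K g, ?_, ?_⟩
  · rw [mem_noetherField_iff]
    intro g
    rw [map_sum]
    exact Fintype.sum_equiv (Equiv.mulLeft g) _ _ fun i => by
      rw [regularFieldAction_eq_perm, RationalFunctionField.perm_var]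
  · intro heq
    simp only [map_sum, RationalFunctionField.map_var] at heq
    simp only [RationalFunctionField.var, ← map_sum] at heq
    have h1 := IsFractionRing.injective (MvPolynomial P K) (RationalFunctionField P K) heq
    -- At the point whose only nonzero coordinate is 1 at `j 1`, the sum over the first copy is 1
    -- and the sum over the second is 0.
    have h2 := congrArg (MvPolynomial.eval fun p => if p = j 1 then (1 : K) else 0) h1
    simp [map_sum, Ne.symm (h _ _)] at h2

theorem IntermediateField.adjoin_map_le_of_adjoin_eq {K E F : Type*} [Field K] [Field E] [Field F]
    [Algebra K E] [Algebra K F] (f : E →ₐ[K] F) {s : Set E} {N : IntermediateField K E}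
    (hs : adjoin K s = N) {M : IntermediateField K F} (h : ∀ u ∈ s, f u ∈ M) : N.map f ≤ M := by
  rw [← hs, adjoin_map, adjoin_le_iff]
  rintro _ ⟨u, hu, rfl⟩
  exact h u hu

theorem IntermediateField.relrank_sup_fieldRange_le {K : Type*} [Field K] {G P : Type*} [Group G] [Finite G]
    (j : G ↪ P) {M : IntermediateField K (RationalFunctionField P K)}
    (h : (noetherField K G).map (RationalFunctionField.map K j) ≤ M) :
    relrank M (M ⊔ (RationalFunctionField.map K j).fieldRange) ≤ (Nat.card G : ℕ) := by
  refine relrank_sup_le ?_ h (relrank_map_noetherField_le K j)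
  rw [AlgHom.fieldRange_eq_map]
  exact map_mono _ le_top

open RationalFunctionField

theorem RationalFunctionField.perm_injective (K : Type*) [Field K] {P : Type*} :
    Function.Injective (perm K : Equiv.Perm P →* _) := by
  intro e e' h
  ext1 p
  have := DFunLike.congr_fun h (var K p)
  rw [perm_var, perm_var] at this
  exact var_injective K this

/-! ### Fixed fields of permutation actions -/

section Permutation

variable (K : Type*) [Field K] {W P : Type*} [Group W] (ω : W →* Equiv.Perm P)

/-- The invariants in `K(P)` of a group acting by permutations of `P`. -/
noncomputable def permInvariants : IntermediateField K (RationalFunctionField P K) :=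
  fixedField ((perm K).comp ω).range

theorem mem_permInvariants_iff (y : RationalFunctionField P K) :
    y ∈ permInvariants K ω ↔ ∀ w, perm K (ω w) y = y :=
  mem_fixedField_range ((perm K).comp ω) y

theorem map_mem_permInvariants {G : Type*} [Group G] (χ : W →* G) (j : G ↪ P)
    (hj : ∀ w g, ω w (j g) = j (χ w * g)) {y : RationalFunctionField G K}
    (hy : y ∈ noetherField K G) : map K j y ∈ permInvariants K ω :=
  (mem_permInvariants_iff K ω _).2 fun w => perm_map_of_mem_noetherField K _ j j (χ w) (hj w) hy

variable [Finite W]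

theorem eq_permInvariants_of_relrank_le (hω : Function.Injective ω)
    {M : IntermediateField K (RationalFunctionField P K)} (hM : M ≤ permInvariants K ω)
    (h : relrank M ⊤ ≤ (Nat.card W : ℕ)) : M = permInvariants K ω := by
  have : Finite ((perm K).comp ω).range :=
    Finite.of_surjective _ ((perm K).comp ω).rangeRestrict_surjective
  refine eq_fixedField_of_rank_le hM (h.trans (le_of_eq ?_))
  congr 1
  exact Nat.card_congr (MonoidHom.ofInjective
    (f := (perm K).comp ω) ((perm_injective K).comp hω)).toEquiv

theorem isAlgebraic_permInvariants :
    Algebra.IsAlgebraic (permInvariants K ω) (RationalFunctionField P K) := by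
  have : Finite ((perm K).comp ω).range :=
    Finite.of_surjective _ ((perm K).comp ω).rangeRestrict_surjective
  have h1 : relrank (permInvariants K ω) ⊤ ≤ _ := rank_fixedField_le ((perm K).comp ω).range
  rw [relrank_top_right] at h1
  have : Module.Finite (permInvariants K ω) (RationalFunctionField P K) :=
    Module.rank_lt_aleph0_iff.1 (h1.trans_lt Cardinal.natCast_lt_aleph0)
  infer_instance

end Permutation

/-! ### The two descriptions of the fixed field -/

/-- The variables on Q and A have degrees at most |Q| and |A| over their Noether fields, with
product the order of the group. Adding invariant generators for the variables indexed by T does not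
increase the total degree. -/
theorem exists_generators_over_noetherField (K : Type*) [Field K] {A Q P T : Type*} [Group A]
    [Group Q] [Finite A] [Finite Q] [Finite T] (ω : A × Q →* Equiv.Perm P)
    (jQ : Q ↪ P) (jz : A ↪ P) (k : T → P)
    (hP : ∀ p, (∃ s, Sum.elim jQ jz s = p) ∨ ∃ t, k t = p)
    (hωQ : ∀ w q, ω w (jQ q) = jQ (w.2 * q)) (hωz : ∀ w a, ω w (jz a) = jz (w.1 * a))
    (hk : ∀ w t, ∃ t', ω w (k t) = k t') (hA : HasNoetherGenerators K A) :
    ∃ t : Finset (RationalFunctionField P K), t.card ≤ Nat.card A + Nat.card T ∧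
      (noetherField K Q).map (map K jQ) ⊔ adjoin K (t : Set (RationalFunctionField P K)) =
        permInvariants K ω := by
  classical
  obtain ⟨sA, hsA, hadjA⟩ := hA
  have hfaithful : ∀ w, (∀ s, ω w (Sum.elim jQ jz s) = Sum.elim jQ jz s) → w = 1 := by
    intro w hw
    have h3 := jQ.injective ((hωQ w 1).symm.trans (hw (.inl 1)))
    have h4 := jz.injective ((hωz w 1).symm.trans (hw (.inr 1)))
    rw [mul_one] at h3 h4
    exact Prod.ext h4 h3
  have hω : Function.Injective ω := (injective_iff_map_eq_one ω).2 fun w hw =>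
    hfaithful w fun s => by rw [hw, Equiv.Perm.one_apply]
  obtain ⟨s, hs, hsinv, htop_sup⟩ := exists_invariants_sup_eq_top K ω (Sum.elim jQ jz) k hP
    (fun w s => by
      rcases s with q | a
      · exact ⟨.inl (w.2 * q), hωQ w q⟩
      · exact ⟨.inr (w.1 * a), hωz w a⟩) hk hfaithful
  set t : Finset (RationalFunctionField P K) := sA.image (map K jz) ∪ s with ht
  refine ⟨t, (Finset.card_union_le _ _).trans (add_le_add (Finset.card_image_le.trans hsA) hs), ?_⟩
  set M := ((noetherField K Q).map (map K jQ)) ⊔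
    adjoin K (t : Set (RationalFunctionField P K)) with hM
  have htM : ∀ y ∈ t, y ∈ M := fun y hy =>
    (le_sup_right : adjoin K (t : Set _) ≤ M) (subset_adjoin K _ hy)
  refine eq_permInvariants_of_relrank_le K ω hω ?_ ?_
  · refine sup_le ?_ ?_
    · rintro _ ⟨y, hy, rfl⟩
      exact map_mem_permInvariants K ω (MonoidHom.snd A Q) jQ hωQ hy
    · rw [adjoin_le_iff]
      intro y hy
      rcases Finset.mem_union.1 (Finset.mem_coe.1 hy) with hy | hy
      · obtain ⟨u, hu, rfl⟩ := Finset.mem_image.1 hy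
        exact map_mem_permInvariants K ω (MonoidHom.fst A Q) jz hωz
          (hadjA ▸ subset_adjoin K _ hu)
      · exact (mem_permInvariants_iff K ω y).2 (hsinv y hy)
  · have h1 := relrank_sup_fieldRange_le jQ (M := M) le_sup_left
    have h2 := relrank_sup_fieldRange_le jz (M := M ⊔ (map K jQ).fieldRange)
      ((adjoin_map_le_of_adjoin_eq _ hadjA fun u hu => htM _ (Finset.mem_union_left _
        (Finset.mem_image_of_mem _ hu))).trans le_sup_left)
    have h3 := relrank_le_mul le_sup_left le_sup_left h1 h2
    have htop : M ⊔ (map K jQ).fieldRange ⊔ (map K jz).fieldRange = ⊤ := by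
      rw [eq_top_iff, ← htop_sup]
      refine sup_le ?_ ?_
      · rw [adjoin_le_iff]
        rintro _ ⟨q | a, rfl⟩
        · have h4 : (map K jQ).fieldRange ≤ M ⊔ (map K jQ).fieldRange ⊔ (map K jz).fieldRange :=
            le_sup_right.trans le_sup_left
          exact h4 ⟨var K q, map_var K jQ q⟩
        · have h4 : (map K jz).fieldRange ≤ M ⊔ (map K jQ).fieldRange ⊔ (map K jz).fieldRange :=
            le_sup_right
          exact h4 ⟨var K a, map_var K jz a⟩
      · rw [adjoin_le_iff]
        have h4 : M ≤ M ⊔ (map K jQ).fieldRange ⊔ (map K jz).fieldRange :=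
          le_sup_left.trans le_sup_left
        exact fun y hy => h4 (htM y (Finset.mem_union_right _ hy))
    rw [htop] at h3
    rwa [Nat.card_prod, mul_comm]

/-- Faithfulness and the cardinality hypothesis say that W is all of (A ≀ ℤ/2) × C, acting on two
copies of A and one of C. The symmetric generators for the two copies of K(A), the generators of
K(C) and the descended variables then suffice. -/
theorem exists_generators_of_swap (K : Type*) [Field K] {A C W P S : Type*} [Group A] [Group C]
    [Group W] [Finite A] [Finite C] [Finite W] [Finite S] (ω : W →* Equiv.Perm P)
    (jx jy : A ↪ P) (jC : C ↪ P) (k : S → P) (χ : W →* C)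
    (hP : ∀ p, (∃ s, Sum.elim (Sum.elim jx jy) jC s = p) ∨ ∃ s, k s = p)
    (hxy : ∀ a b, jx a ≠ jy b)
    (hωC : ∀ w c, ω w (jC c) = jC (χ w * c))
    (hωxy : ∀ w, (∃ b b' : A, (∀ a, ω w (jx a) = jx (b * a)) ∧ ∀ a, ω w (jy a) = jy (b' * a)) ∨
      ∃ b b' : A, (∀ a, ω w (jx a) = jy (b * a)) ∧ ∀ a, ω w (jy a) = jx (b' * a))
    (hk : ∀ w s, ∃ s', ω w (k s) = k s')
    (hfaithful : ∀ w, (∀ s, ω w (Sum.elim (Sum.elim jx jy) jC s) = Sum.elim (Sum.elim jx jy) jC s) →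
      w = 1)
    (hcard : Nat.card W = 2 * Nat.card A * Nat.card A * Nat.card C)
    (hA : HasNoetherGenerators K A) (hC : HasNoetherGenerators K C) :
    ∃ t : Finset (RationalFunctionField P K),
      t.card ≤ 2 * Nat.card A + Nat.card C + Nat.card S ∧
      adjoin K (t : Set (RationalFunctionField P K)) = permInvariants K ω := by
  classical
  obtain ⟨sA, hsA, hadjA⟩ := hA
  obtain ⟨sC, hsC, hadjC⟩ := hC
  have hω : Function.Injective ω := (injective_iff_map_eq_one ω).2 fun w hw =>
    hfaithful w fun s => by rw [hw, Equiv.Perm.one_apply]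
  obtain ⟨s, hs, hsinv, htop_sup⟩ := exists_invariants_sup_eq_top K ω
    (Sum.elim (Sum.elim jx jy) jC) k hP
    (fun w s => by
      rcases s with (a | a) | c
      · rcases hωxy w with ⟨b, b', h, h'⟩ | ⟨b, b', h, h'⟩
        · exact ⟨.inl (.inl (b * a)), h a⟩
        · exact ⟨.inl (.inr (b * a)), h a⟩
      · rcases hωxy w with ⟨b, b', h, h'⟩ | ⟨b, b', h, h'⟩
        · exact ⟨.inl (.inr (b' * a)), h' a⟩
        · exact ⟨.inl (.inl (b' * a)), h' a⟩
      · exact ⟨.inr (χ w * c), hωC w c⟩) hk hfaithful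
  -- Embeddings agreeing on all generators would agree on all of K(A), against
  -- `exists_mem_noetherField_map_ne`.
  obtain ⟨u₀, hu₀, hne⟩ : ∃ u ∈ sA, map K jx u ≠ map K jy u := by
    by_contra! hcon
    obtain ⟨x, hx, hxne⟩ := exists_mem_noetherField_map_ne K jx jy hxy
    refine hxne ?_
    rw [← hadjA] at hx
    clear hxne
    induction hx using adjoin_induction with
    | mem y hy => exact hcon y hy
    | algebraMap a => simp
    | add y z _ _ hy hz => simp [hy, hz]
    | inv y _ hy => simp [hy]
    | mul y z _ _ hy hz => simp [hy, hz]
  obtain ⟨t, htcard, htform, B, htB, hBrank, hB⟩ :=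
    exists_symmetric_generators (K := K) (map K jx) (map K jy) sA hu₀ hne
  have hmemN : ∀ u ∈ sA, u ∈ noetherField K A := fun u hu => hadjA ▸ subset_adjoin K _ hu
  have htinv : ∀ y ∈ t, y ∈ permInvariants K ω := by
    intro y hy
    refine (mem_permInvariants_iff K ω y).2 fun w => ?_
    obtain ⟨u, hu, hform⟩ := htform y hy
    rcases hωxy w with ⟨b, b', h, h'⟩ | ⟨b, b', h, h'⟩
    · have hx' : ∀ u ∈ sA, perm K (ω w) (map K jx u) = map K jx u := fun u hu =>
        perm_map_of_mem_noetherField K _ jx jx b h (hmemN u hu)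
      have hy' : ∀ u ∈ sA, perm K (ω w) (map K jy u) = map K jy u := fun u hu =>
        perm_map_of_mem_noetherField K _ jy jy b' h' (hmemN u hu)
      rcases hform with rfl | rfl | rfl <;>
        simp only [map_add, map_mul, hx' u hu, hy' u hu, hx' u₀ hu₀, hy' u₀ hu₀]
    · have hx' : ∀ u ∈ sA, perm K (ω w) (map K jx u) = map K jy u := fun u hu =>
        perm_map_of_mem_noetherField K _ jx jy b h (hmemN u hu)
      have hy' : ∀ u ∈ sA, perm K (ω w) (map K jy u) = map K jx u := fun u hu =>
        perm_map_of_mem_noetherField K _ jy jx b' h' (hmemN u hu)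
      rcases hform with rfl | rfl | rfl <;>
        simp only [map_add, map_mul, hx' u hu, hy' u hu, hx' u₀ hu₀, hy' u₀ hu₀]
      · exact add_comm _ _
      · exact add_comm _ _
      · exact mul_comm _ _
  set t₂ : Finset (RationalFunctionField P K) := (t ∪ sC.image (map K jC)) ∪ s with ht₂
  refine ⟨t₂, ?_, ?_⟩
  · refine (Finset.card_union_le _ _).trans (add_le_add ((Finset.card_union_le _ _).trans
      (add_le_add (htcard.trans (by omega)) (Finset.card_image_le.trans hsC))) hs)
  set M := adjoin K (t₂ : Set (RationalFunctionField P K)) with hM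
  have htM : ∀ y ∈ t₂, y ∈ M := fun y hy => subset_adjoin K _ hy
  refine eq_permInvariants_of_relrank_le K ω hω ?_ ?_
  · rw [adjoin_le_iff]
    intro y hy
    rcases Finset.mem_union.1 (Finset.mem_coe.1 hy) with hy | hy
    · rcases Finset.mem_union.1 hy with hy | hy
      · exact htinv y hy
      · obtain ⟨u, hu, rfl⟩ := Finset.mem_image.1 hy
        exact map_mem_permInvariants K ω χ jC hωC (hadjC ▸ subset_adjoin K _ hu)
    · exact (mem_permInvariants_iff K ω y).2 (hsinv y hy)
  · have htM' : adjoin K (t : Set (RationalFunctionField P K)) ≤ M := adjoin_le_iff.2 fun y hy =>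
      htM y (Finset.mem_union_left _ (Finset.mem_union_left _ hy))
    -- The tower separates the two copies of K(A), then adjoins the x, y and C variables, with
    -- degrees at most 2, |A|, |A| and |C|. The product is |W|.
    have h1 := relrank_sup_le htB htM' hBrank
    set M₁ := M ⊔ B with hM₁
    have hMM₁ : M ≤ M₁ := le_sup_left
    have hBM₁ : B ≤ M₁ := le_sup_right
    have h2 := relrank_sup_fieldRange_le jx (M := M₁)
      ((adjoin_map_le_of_adjoin_eq _ hadjA fun u hu => (hB u hu).1).trans hBM₁)
    set M₂ := M₁ ⊔ (map K jx).fieldRange with hM₂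
    have hMM₂ : M₁ ≤ M₂ := le_sup_left
    have h3 := relrank_sup_fieldRange_le jy (M := M₂)
      ((adjoin_map_le_of_adjoin_eq _ hadjA fun u hu => (hB u hu).2).trans (hBM₁.trans hMM₂))
    set M₃ := M₂ ⊔ (map K jy).fieldRange with hM₃
    have hMM₃ : M₂ ≤ M₃ := le_sup_left
    have hMM : M ≤ M₃ := hMM₁.trans (hMM₂.trans hMM₃)
    have h4 := relrank_sup_fieldRange_le jC (M := M₃)
      ((adjoin_map_le_of_adjoin_eq _ hadjC fun u hu => htM _ (Finset.mem_union_left _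
        (Finset.mem_union_right _ (Finset.mem_image_of_mem _ hu)))).trans hMM)
    have h12 := relrank_le_mul hMM₁ hMM₂ h1 h2
    have h123 := relrank_le_mul (hMM₁.trans hMM₂) hMM₃ h12 h3
    have h1234 := relrank_le_mul hMM le_sup_left h123 h4
    have htop : M₃ ⊔ (map K jC).fieldRange = ⊤ := by
      have hle : M₃ ≤ M₃ ⊔ (map K jC).fieldRange := le_sup_left
      rw [eq_top_iff, ← htop_sup]
      refine sup_le ?_ ?_
      · rw [adjoin_le_iff]
        rintro _ ⟨(a | a) | c, rfl⟩
        · have h5 : (map K jx).fieldRange ≤ M₂ := le_sup_right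
          exact hle (hMM₃ (h5 ⟨var K a, map_var K jx a⟩))
        · have h5 : (map K jy).fieldRange ≤ M₃ := le_sup_right
          exact hle (h5 ⟨var K a, map_var K jy a⟩)
        · have h5 : (map K jC).fieldRange ≤ M₃ ⊔ (map K jC).fieldRange := le_sup_right
          exact h5 ⟨var K c, map_var K jC c⟩
      · rw [adjoin_le_iff]
        exact fun y hy => hle (hMM (htM y (Finset.mem_union_right _ hy)))
    rw [htop] at h1234
    rwa [hcard]

/-- Let `A × Q` act faithfully on two copies of `A`, by translations and swaps, together with a
group `C` through a character of `Q`, where `|Q| = 2 |A| |C|`. If `K(A)` and `K(C)` are generated by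
`|A|` and `|C|` elements, then `K(Q)` is stably rational. -/
theorem isStablyRationalExtension_noetherField_of_action (K : Type*) [Field K] {A Q C : Type*}
    [Group A] [Group Q] [Group C] [Finite A] [Finite Q] [Finite C]
    (θ : A × Q →* Equiv.Perm (A ⊕ A)) (χ : Q →* C)
    (hθ : ∀ w, (∃ b b' : A, (∀ a, θ w (.inl a) = .inl (b * a)) ∧ ∀ a, θ w (.inr a) = .inr (b' * a)) ∨
      ∃ b b' : A, (∀ a, θ w (.inl a) = .inr (b * a)) ∧ ∀ a, θ w (.inr a) = .inl (b' * a))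
    (hfaithful : ∀ w, θ w = 1 → χ w.2 = 1 → w = 1)
    (hcard : Nat.card Q = 2 * Nat.card A * Nat.card C)
    (hA : HasNoetherGenerators K A) (hC : HasNoetherGenerators K C) :
    IsStablyRationalExtension K (noetherField K Q) := by
  let ω₁ : A × Q →* Equiv.Perm (Q ⊕ A) := (Equiv.Perm.sumCongrHom Q A).comp
    (((MulAction.toPermHom Q Q).comp (MonoidHom.snd A Q)).prod
      ((MulAction.toPermHom A A).comp (MonoidHom.fst A Q)))
  let ω₂ : A × Q →* Equiv.Perm ((A ⊕ A) ⊕ C) := (Equiv.Perm.sumCongrHom (A ⊕ A) C).comp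
    (θ.prod (((MulAction.toPermHom C C).comp χ).comp (MonoidHom.snd A Q)))
  let ω : A × Q →* Equiv.Perm ((Q ⊕ A) ⊕ ((A ⊕ A) ⊕ C)) :=
    (Equiv.Perm.sumCongrHom _ _).comp (ω₁.prod ω₂)
  let jQ : Q ↪ (Q ⊕ A) ⊕ ((A ⊕ A) ⊕ C) := ⟨fun q => .inl (.inl q), fun _ _ h => by simpa using h⟩
  let jz : A ↪ (Q ⊕ A) ⊕ ((A ⊕ A) ⊕ C) := ⟨fun a => .inl (.inr a), fun _ _ h => by simpa using h⟩
  let jx : A ↪ (Q ⊕ A) ⊕ ((A ⊕ A) ⊕ C) :=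
    ⟨fun a => .inr (.inl (.inl a)), fun _ _ h => by simpa using h⟩
  let jy : A ↪ (Q ⊕ A) ⊕ ((A ⊕ A) ⊕ C) :=
    ⟨fun a => .inr (.inl (.inr a)), fun _ _ h => by simpa using h⟩
  let jC : C ↪ (Q ⊕ A) ⊕ ((A ⊕ A) ⊕ C) := ⟨fun c => .inr (.inr c), fun _ _ h => by simpa using h⟩
  have hωC : ∀ w c, ω w (jC c) = jC (χ w.2 * c) := fun w q => rfl
  have hωxy : ∀ w (p : A ⊕ A), ω w (.inr (.inl p)) = .inr (.inl (θ w p)) := fun w p => rfl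
  obtain ⟨t₁, ht₁, hM₁⟩ := exists_generators_over_noetherField K ω jQ jz Sum.inr
    (fun p => by
      rcases p with (q | a) | p
      · exact Or.inl ⟨.inl q, rfl⟩
      · exact Or.inl ⟨.inr a, rfl⟩
      · exact Or.inr ⟨p, rfl⟩)
    (fun w q => rfl) (fun w a => rfl) (fun w t => ⟨ω₂ w t, rfl⟩) hA
  obtain ⟨t₂, ht₂, hM₂⟩ := exists_generators_of_swap K ω jx jy jC Sum.inl
    (χ.comp (MonoidHom.snd A Q))
    (fun p => by
      rcases p with p | (a | a) | c
      · exact Or.inr ⟨p, rfl⟩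
      · exact Or.inl ⟨.inl (.inl a), rfl⟩
      · exact Or.inl ⟨.inl (.inr a), rfl⟩
      · exact Or.inl ⟨.inr c, rfl⟩)
    (fun a b => Sum.inr_injective.ne (Sum.inl_injective.ne Sum.inl_ne_inr)) hωC
    (fun w => by
      rcases hθ w with ⟨b, b', h, h'⟩ | ⟨b, b', h, h'⟩
      · exact Or.inl ⟨b, b', fun a => (hωxy w _).trans (congrArg _ (congrArg _ (h a))),
          fun a => (hωxy w _).trans (congrArg _ (congrArg _ (h' a)))⟩
      · exact Or.inr ⟨b, b', fun a => (hωxy w _).trans (congrArg _ (congrArg _ (h a))),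
          fun a => (hωxy w _).trans (congrArg _ (congrArg _ (h' a)))⟩)
    (fun w s => ⟨ω₁ w s, rfl⟩)
    (fun w hw => by
      refine hfaithful w ?_ ?_
      · ext1 p
        have h1 : ∀ p : A ⊕ A, ω w (.inr (.inl p)) = .inr (.inl p) := fun p => by
          rcases p with a | a
          · exact hw (.inl (.inl a))
          · exact hw (.inl (.inr a))
        have := (hωxy w p).symm.trans (h1 p)
        simpa using this
      · have := jC.injective ((hωC w 1).symm.trans (hw (.inr 1)))
        rwa [mul_one] at this)
    (by rw [Nat.card_prod, hcard]; ring) hA hC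
  have := Fintype.ofFinite A
  have := Fintype.ofFinite Q
  have := Fintype.ofFinite C
  have := isAlgebraic_permInvariants K ω
  simp only [Nat.card_eq_fintype_card, Fintype.card_sum] at ht₁ ht₂
  -- Here d = |P| and m = |A| + |(A ⊔ A) ⊔ C| = |P| - |Q|, so both generating sets have exactly the
  -- permitted sizes.
  refine isStablyRationalExtension_of_generators ((map K jQ).comp (noetherField K Q).val)
    (permInvariants K ω) (trdeg_noetherField K) (RationalFunctionField.trdeg_eq _ K) ?_ ht₁ ?_ ?_ hM₂
  · simp only [Fintype.card_sum, Nat.card_eq_fintype_card]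
    omega
  · simp only [Fintype.card_sum]
    omega
  · rw [← hM₁, AlgHom.fieldRange_eq_map, ← IntermediateField.map_map, ← AlgHom.fieldRange_eq_map,
      fieldRange_val]

/-! ### Dihedral groups and their action on two copies of ℤ/n -/

section Dihedral

open Multiplicative

/-- The group `ℤ/n × D_n` acts on two copies of `ℤ/n`: `ℤ/n` translates both copies, rotations
translate the copies in opposite directions, and reflections exchange them. -/
def dihedralTranslate (n : ℕ) (w : Multiplicative (ZMod n) × DihedralGroup n) :
    Multiplicative (ZMod n) ⊕ Multiplicative (ZMod n) →
      Multiplicative (ZMod n) ⊕ Multiplicative (ZMod n) :=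
  match w with
  | (a, .r i) => Sum.elim (fun j => .inl (a * ofAdd i * j)) (fun j => .inr (a * ofAdd (-i) * j))
  | (a, .sr i) => Sum.elim (fun j => .inr (a * ofAdd i * j)) (fun j => .inl (a * ofAdd (-i) * j))

/-- The permutation action of `ℤ/n × D_n` on two copies of `ℤ/n`. -/
def dihedralPerm (n : ℕ) : Multiplicative (ZMod n) × DihedralGroup n →*
    Equiv.Perm (Multiplicative (ZMod n) ⊕ Multiplicative (ZMod n)) :=
  MonoidHom.toHomPerm
    { toFun := dihedralTranslate n
      map_one' := by
        funext p
        change dihedralTranslate n (1, .r 0) p = p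
        rcases p with p | p <;> simp [dihedralTranslate]
      map_mul' := by
        rintro ⟨a, i | i⟩ ⟨b, j | j⟩ <;> funext p <;> rcases p with p | p <;>
          simp only [dihedralTranslate, Prod.mk_mul_mk, DihedralGroup.r_mul_r, DihedralGroup.r_mul_sr,
            DihedralGroup.sr_mul_r, DihedralGroup.sr_mul_sr, Sum.elim_inl, Sum.elim_inr] <;> congr 1 <;> apply Multiplicative.toAdd.injective <;>
          simp only [toAdd_mul, toAdd_ofAdd] <;> ring }

theorem dihedralPerm_apply (n : ℕ) (w : Multiplicative (ZMod n) × DihedralGroup n)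
    (p : Multiplicative (ZMod n) ⊕ Multiplicative (ZMod n)) :
    dihedralPerm n w p = dihedralTranslate n w p := rfl

theorem dihedralPerm_translate_or_swap (n : ℕ) (w : Multiplicative (ZMod n) × DihedralGroup n) :
    (∃ b b' : Multiplicative (ZMod n), (∀ a, dihedralPerm n w (.inl a) = .inl (b * a)) ∧
      ∀ a, dihedralPerm n w (.inr a) = .inr (b' * a)) ∨
    ∃ b b' : Multiplicative (ZMod n), (∀ a, dihedralPerm n w (.inl a) = .inr (b * a)) ∧
      ∀ a, dihedralPerm n w (.inr a) = .inl (b' * a) := by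
  obtain ⟨a, i | i⟩ := w
  · exact Or.inl ⟨_, _, fun _ => rfl, fun _ => rfl⟩
  · exact Or.inr ⟨_, _, fun _ => rfl, fun _ => rfl⟩

theorem eq_one_of_dihedralPerm_eq_one {n : ℕ} (hn : Odd n)
    (w : Multiplicative (ZMod n) × DihedralGroup n) (hw : dihedralPerm n w = 1) : w = 1 := by
  have h1 := Equiv.congr_fun hw (.inl 1)
  have h2 := Equiv.congr_fun hw (.inr 1)
  rw [dihedralPerm_apply, Equiv.Perm.one_apply] at h1 h2
  obtain ⟨a, i | i⟩ := w
  · simp only [dihedralTranslate, Sum.elim_inl, Sum.elim_inr, mul_one] at h1 h2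
    have h3 := congrArg toAdd (Sum.inl_injective h1)
    have h4 := congrArg toAdd (Sum.inr_injective h2)
    simp only [toAdd_mul, toAdd_ofAdd, toAdd_one] at h3 h4
    -- The two copies are translated by a + i and a - i. Both being trivial gives 2i = 0, and 2 is
    -- invertible since n is odd.
    have h5 : (2 : ZMod n) * i = 0 := by linear_combination h3 - h4
    have hunit : IsUnit (2 : ZMod n) := by
      have := (ZMod.isUnit_iff_coprime 2 n).2 (Nat.coprime_two_left.2 hn)
      simpa using this
    have h6 : i = 0 := by simpa using (hunit.mul_right_eq_zero).1 h5
    subst h6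
    have h7 : a = 1 := by
      apply Multiplicative.toAdd.injective
      simpa using h3
    rw [h7]
    rfl
  · simp [dihedralTranslate] at h1

/-- The quotient map `D_m → D_n` for `n ∣ m`. -/
def dihedralCast {m n : ℕ} (h : n ∣ m) : DihedralGroup m →* DihedralGroup n where
  toFun
    | .r i => .r (ZMod.castHom h (ZMod n) i)
    | .sr i => .sr (ZMod.castHom h (ZMod n) i)
  map_one' := by
    change DihedralGroup.r (ZMod.castHom h (ZMod n) 0) = DihedralGroup.r 0
    rw [map_zero]
  map_mul' := by
    rintro (i | i) (j | j) <;>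
      simp only [DihedralGroup.r_mul_r, DihedralGroup.r_mul_sr,
            DihedralGroup.sr_mul_r, DihedralGroup.sr_mul_sr, map_add, map_sub]

/-- The character of `D_m`, `m` even, given by the parity of the exponent of the rotation. -/
def dihedralParity {m : ℕ} (h : 2 ∣ m) : DihedralGroup m →* Multiplicative (ZMod 2) where
  toFun
    | .r i => ofAdd (ZMod.castHom h (ZMod 2) i)
    | .sr i => ofAdd (ZMod.castHom h (ZMod 2) i)
  map_one' := by
    change ofAdd (ZMod.castHom h (ZMod 2) 0) = 1
    rw [map_zero, ofAdd_zero]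
  map_mul' := by
    -- Signs disappear modulo 2, so the exponent is additive even across reflections.
    have hsub : ∀ a b : ZMod 2, b - a = a + b := by decide
    rintro (i | i) (j | j) <;>
      simp only [DihedralGroup.r_mul_r, DihedralGroup.r_mul_sr,
            DihedralGroup.sr_mul_r, DihedralGroup.sr_mul_sr, map_add, map_sub, hsub, ofAdd_add]

theorem eq_one_of_dihedralCast_of_dihedralParity {n : ℕ} (hn : Odd n)
    (g : DihedralGroup (2 * n)) (h : dihedralCast (Dvd.intro_left 2 rfl : n ∣ 2 * n) g = 1)
    (h' : dihedralParity (Dvd.intro n rfl : 2 ∣ 2 * n) g = 1) : g = 1 := by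
  have hn0 : n ≠ 0 := by rintro rfl; simp at hn
  have : NeZero (2 * n) := ⟨by omega⟩
  obtain i | i := g
  · have h1 : (ZMod.castHom (Dvd.intro_left 2 rfl : n ∣ 2 * n) (ZMod n)) i = 0 := by
      have : DihedralGroup.r (ZMod.castHom (Dvd.intro_left 2 rfl : n ∣ 2 * n) (ZMod n) i) =
        DihedralGroup.r 0 := h
      exact DihedralGroup.r.inj this
    have h2 : (ZMod.castHom (Dvd.intro n rfl : 2 ∣ 2 * n) (ZMod 2)) i = 0 :=
      congrArg toAdd h'
    rw [← ZMod.natCast_zmod_val i, map_natCast, ZMod.natCast_eq_zero_iff] at h1 h2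
    -- For odd n, a rotation exponent that vanishes modulo 2 and modulo n vanishes modulo 2n. The
    -- kernel of D_{2n} → D_n is thus detected by the parity character.
    have h3 := (Nat.coprime_two_left.2 hn).mul_dvd_of_dvd_of_dvd h2 h1
    have h4 : i = 0 := by
      rw [← ZMod.natCast_zmod_val i, ZMod.natCast_eq_zero_iff]
      exact h3
    rw [h4]
    rfl
  · have h1 : DihedralGroup.sr (ZMod.castHom (Dvd.intro_left 2 rfl : n ∣ 2 * n) (ZMod n) i) =
      DihedralGroup.r 0 := h
    cases h1

end Dihedral

/-! ### The main theorem -/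

theorem theorem4p2 (K : Type*) [Field K] (n : ℕ) (hn : Odd n)
    (h : IsRationalExtension K (noetherField K (Multiplicative (ZMod n)))) :
    IsStablyRationalExtension K (noetherField K (DihedralGroup n)) ∧
      IsStablyRationalExtension K (noetherField K (DihedralGroup (2 * n))) := by
  have : NeZero n := ⟨by rintro rfl; simp at hn⟩
  have : NeZero (2 * n) := ⟨by have := NeZero.ne n; omega⟩
  have hA := h.hasNoetherGenerators
  have hcardA : Nat.card (Multiplicative (ZMod n)) = n := by simp
  constructor
  -- For D_n the action on the two copies is already faithful and 2n = 2|A|, so C is taken trivial,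
  -- as ℤ/1.
  · refine isStablyRationalExtension_noetherField_of_action K (dihedralPerm n)
      (1 : DihedralGroup n →* Multiplicative (ZMod 1)) (dihedralPerm_translate_or_swap n)
      (fun w hw _ => eq_one_of_dihedralPerm_eq_one hn w hw) ?_ hA
      (hasNoetherGenerators_of_subsingleton K)
    rw [DihedralGroup.nat_card, hcardA]
    simp
  -- For D_{2n} the action factors through D_n, and C = ℤ/2 with the parity character restores
  -- faithfulness.
  · refine isStablyRationalExtension_noetherField_of_action K
      ((dihedralPerm n).comp ((MonoidHom.id _).prodMap (dihedralCast (Dvd.intro_left 2 rfl))))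
      (dihedralParity (Dvd.intro n rfl)) (fun w => dihedralPerm_translate_or_swap n _)
      (fun w hw hw' => ?_) ?_ hA (hasNoetherGenerators_zmod_two K)
    · have h1 := eq_one_of_dihedralPerm_eq_one hn _ hw
      have h2 : w.1 = 1 := congrArg Prod.fst h1
      have h3 : dihedralCast (Dvd.intro_left 2 rfl) w.2 = 1 := congrArg Prod.snd h1
      exact Prod.ext h2 (eq_one_of_dihedralCast_of_dihedralParity hn w.2 h3 hw')
    · rw [DihedralGroup.nat_card, hcardA]
      simp
      ring
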